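/- For a set $X$ with base point $e$, let $J_n(X)=X^n/\!\sim$, where $\sim$ is the equivalence relation generated by $(x_1,\dots,x_{i-1},e,x_{i+1},\dots,x_n)\sim(x_1,\dots,x_{i-1},x_{i+1},\dots,x_n,e)$ for $1\le i\le n$, and let $q_n\colon X^n\to J_n(X)$ be the quotient map. A complex variety is a reduced separated scheme of finite type over $\mathbb{C}$; it is normal if all its local rings are integrally closed domains. Proposition. Let $m\geq 1$ and $n>1$, and let $\mathbb{P}^m$ be complex projective space with any base point $e\in\mathbb{P}^m(\mathbb{C})$. Suppose $J_n\mathbb{P}^m=J_n(\mathbb{P}^m(\mathbb{C}))$ can be given the structure of a complex variety such that $q_n\colon(\mathbb{P}^m)^n\to J_n\mathbb{P}^m$ is a map of varieties; that is, suppose that there are a complex variety $Y$, a bijection $\varphi\colon J_n(\mathbb{P}^m(\mathbb{C}))\to Y(\mathbb{C})$ and a morphism $q\colon(\mathbb{P}^m)^n\to Y$ of schemes over $\mathbb{C}$ which is given on complex points by $\varphi\circ q_n$. Then $Y$ is not normal, $Y$ is integral, and $q$ is the normalization map of $Y$: there is an isomorphism $i\colon(\mathbb{P}^m)^n\to\widetilde{Y}$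 with $\nu\circ i=q$, where $\nu\colon\widetilde{Y}\to Y$ is the normalization of $Y$ in its function field. -/

import Mathlib

open CategoryTheory CategoryTheory.Limits AlgebraicGeometry

noncomputable section

namespace JamesVariety

/-! ### The James reduced product -/

/-- The generating identifications
`(x₁, …, xᵢ₋₁, e, xᵢ₊₁, …, xₙ) ∼ (x₁, …, xᵢ₋₁, xᵢ₊₁, …, xₙ, e)` on `X ^ n`:
here `y` is the `(n - 1)`-tuple obtained by deleting the entry `e` in position `i`. -/
inductive JamesRel {X : Type*} (e : X) : (n : ℕ) → (Fin n → X) → (Fin n → X) → Prop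
  | move {k : ℕ} (i : Fin (k + 1)) (y : Fin k → X) :
      JamesRel e (k + 1) (Fin.insertNth (α := fun _ => X) i e y)
        (Fin.snoc (α := fun _ => X) y e)

/-- The `n`-th stage `J_n(X) = X ^ n / ∼` of the James reduced product of `(X, e)`: the quotient of
`X ^ n` by the equivalence relation generated by `JamesRel e n`. -/
def James {X : Type*} (e : X) (n : ℕ) : Type _ :=
  Quot (JamesRel e n)

/-- The quotient map `q_n : X ^ n → J_n(X)`. -/
def James.mk {X : Type*} (e : X) {n : ℕ} (x : Fin n → X) : James e n :=
  Quot.mk _ x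

/-! ### Complex varieties and their points -/

/-- Schemes over the complex numbers. -/
abbrev SchC : Type 1 := Over (Spec (CommRingCat.of ℂ))

/-- A complex variety: a reduced, separated scheme of finite type over `ℂ`
(not assumed to be irreducible). -/
structure IsComplexVariety (Y : SchC) : Prop where
  isReduced : IsReduced Y.left
  isSeparated : IsSeparated Y.hom
  locallyOfFiniteType : LocallyOfFiniteType Y.hom
  quasiCompact : QuasiCompact Y.hom

/-- The set `Y(ℂ)` of complex points: the `ℂ`-morphisms `Spec ℂ ⟶ Y`. -/
abbrev Points (Y : SchC) : Type :=
  Over.mk (𝟙 (Spec (CommRingCat.of ℂ))) ⟶ Y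

attribute [local instance] MvPolynomial.gradedAlgebra in
/-- Projective space `ℙ^m = Proj ℂ[x₀, …, xₘ]` as a scheme over `ℂ`. -/
def projSpace (m : ℕ) : SchC :=
  Over.mk (Proj.toSpecZero (MvPolynomial.homogeneousSubmodule (Fin (m + 1)) ℂ) ≫
    Spec.map (CommRingCat.ofHom
      (algebraMap ℂ (MvPolynomial.homogeneousSubmodule (Fin (m + 1)) ℂ 0))))

/-- The `n`-fold product `X × ⋯ × X` over `ℂ`. -/
def power (X : SchC) (n : ℕ) : SchC :=
  ∏ᶜ fun _ : Fin n => X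

/-- The complex point `(x₁, …, xₙ)` of `X ^ n`. -/
def tuple {X : SchC} {n : ℕ} (x : Fin n → Points X) : Points (power X n) :=
  Pi.lift x

/-! ### Normality and normalization -/

/-- A scheme is normal if all its local rings are integrally closed domains. -/
def IsNormalScheme (Y : Scheme.{0}) : Prop :=
  ∀ y : Y, IsDomain (Y.presheaf.stalk y) ∧ IsIntegrallyClosed (Y.presheaf.stalk y)

/-- The inclusion `Spec K(Y) ⟶ Y` of the generic point of an integral scheme,
where `K(Y)` is the function field. -/
def fromGeneric (Y : Scheme.{0}) [IsIntegral Y] : Spec Y.functionField ⟶ Y :=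
  Y.fromSpecStalk (genericPoint Y)

instance (Y : Scheme.{0}) [IsIntegral Y] : QuasiCompact (fromGeneric Y) where
  isCompact_preimage _ _ _ :=
    have : Subsingleton (Spec Y.functionField) :=
      inferInstanceAs (Subsingleton (PrimeSpectrum Y.functionField))
    Set.subsingleton_of_subsingleton.isCompact

instance (Y : Scheme.{0}) [IsIntegral Y] : QuasiSeparated (fromGeneric Y) := by
  unfold fromGeneric
  infer_instance

/-- The normalization of an integral scheme `Y`: the relative normalization of `Y` in its function
field, glued from the spectra of the integral closures of `Γ(Y, U)` in `K(Y)` for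
`U ⊆ Y` affine open. -/
def normalization (Y : Scheme.{0}) [IsIntegral Y] : Scheme.{0} :=
  (fromGeneric Y).normalization

/-- The canonical morphism `ν` from the normalization of `Y` to `Y`. -/
def normalizationHom (Y : Scheme.{0}) [IsIntegral Y] : normalization Y ⟶ Y :=
  (fromGeneric Y).fromNormalization

/-- `f : X ⟶ Y` is the normalization map of `Y`: `Y` is integral, and `f` is identified with
the canonical morphism from the normalization of `Y` by an isomorphism over `Y`. -/
def IsNormalizationMap {X Y : Scheme.{0}} (f : X ⟶ Y) : Prop :=
  ∃ (_ : IsIntegral Y) (i : X ≅ normalization Y), i.hom ≫ normalizationHom Y = f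

end JamesVariety

end

noncomputable section

namespace JamesVariety

/-! ### Complex points -/

/-! The morphism `q` is finite and birational, and its source is a normal integral scheme; such a
morphism is the normalization of its target. If `Y` were normal, `q` would be an isomorphism, hence
injective on complex points, whereas `q_n` identifies `(e, a, …, a)` with `(a, …, a, e)` for `a ≠
e`.

Finiteness: `q` is proper because the power of projective space is proper and `Y` is separated. The
word of entries different from `e` is an invariant of a class in `J_n`, so the fibres of `q_n` are
finite (`James.finite_fiber`). Finite fibres over complex points suffice, since `ℂ`-schemes locally
of finite type are Jacobson with complex points as closed points (`isFinite_of_finite_fibers`). The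
same principle makes `q` surjective, so the reduced scheme `Y` is integral.

Birationality: on the open set of tuples avoiding `e`, the map `q_n` is injective, and there `q` is
universally injective (`universallyInjective_offBasePoint`). The extension of function fields is
therefore purely inseparable, hence trivial in characteristic zero (`isIso_stalkMap_of_restrict`).

Normality and integrality of the source: it is covered by affine spaces through a common point
(`HasAffineSpaceCover.power`). The commutative algebra of the conclusion is in
`isIso_of_isNormalScheme`. -/

/-- The closed point of `Z` underlying a complex point. -/
def Points.pt {Z : SchC} (p : Points Z) : Z.left :=
  p.left (IsLocalRing.closedPoint ℂ)

lemma Points.left_comp_hom {Z : SchC} (p : Points Z) : p.left ≫ Z.hom = 𝟙 _ := Over.w p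

@[simp]
lemma Points.pt_comp {Z W : SchC} (p : Points Z) (f : Z ⟶ W) :
    Points.pt (p ≫ f) = f.left p.pt := by
  rfl

lemma Points.pt_injective (Z : SchC) [LocallyOfFiniteType Z.hom] :
    Function.Injective (Points.pt (Z := Z)) := fun p p' h ↦ by
  ext1
  exact ext_of_apply_closedPoint_eq Z.hom p.left_comp_hom p'.left_comp_hom h

lemma Points.isClosed_pt {Z : SchC} [LocallyOfFiniteType Z.hom] (p : Points Z) :
    IsClosed {p.pt} :=
  (pointEquivClosedPoint Z.hom ⟨p.left, p.left_comp_hom⟩).2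

lemma Points.exists_pt_eq {Z : SchC} [LocallyOfFiniteType Z.hom] {z : Z.left}
    (hz : IsClosed {z}) : ∃ p : Points Z, p.pt = z :=
  ⟨Over.homMk (pointOfClosedPoint Z.hom z hz) (pointOfClosedPoint_comp Z.hom z hz),
    pointOfClosedPoint_apply Z.hom z hz _⟩

lemma jacobsonSpace (Z : SchC) [LocallyOfFiniteType Z.hom] : JacobsonSpace Z.left :=
  LocallyOfFiniteType.jacobsonSpace Z.hom

/-- Nullstellensatz: in a Jacobson space every nonempty locally closed set contains a closed point,
and over `ℂ` closed points are complex points. -/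
lemma Points.exists_pt_mem {Z : SchC} [LocallyOfFiniteType Z.hom] {S : Set Z.left}
    (hS : IsLocallyClosed S) (hne : S.Nonempty) : ∃ p : Points Z, p.pt ∈ S := by
  have := jacobsonSpace Z
  obtain ⟨z, hzS, hz⟩ := nonempty_inter_closedPoints hne hS
  obtain ⟨p, rfl⟩ := exists_pt_eq hz
  exact ⟨p, hzS⟩

lemma eq_univ_of_forall_pt_mem {Z : SchC} [LocallyOfFiniteType Z.hom] {S : Set Z.left}
    (hS : IsLocallyClosed Sᶜ) (h : ∀ p : Points Z, p.pt ∈ S) : S = Set.univ := by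
  by_contra hne
  obtain ⟨p, hp⟩ := Points.exists_pt_mem hS (Set.nonempty_compl.mpr hne)
  exact hp (h p)

lemma surjective_of_forall_point {Z W : SchC} [LocallyOfFiniteType W.hom] (f : Z ⟶ W)
    (hf : IsClosedMap f.left) (h : Function.Surjective fun p : Points Z ↦ p ≫ f) :
    Function.Surjective f.left := by
  rw [← Set.range_eq_univ]
  refine eq_univ_of_forall_pt_mem hf.isClosed_range.isOpen_compl.isLocallyClosed fun p ↦ ?_
  obtain ⟨p, rfl⟩ := h p
  exact ⟨p.pt, by simp⟩

/-- Universal injectivity means that the diagonal is surjective. The diagonal is closed because `f`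
is separated, so it is enough that it contains every complex point of the fibre product, that is,
every pair of complex points with the same image. -/
lemma universallyInjective_of_injective_points {Z W : SchC} [LocallyOfFiniteType Z.hom]
    [LocallyOfFiniteType W.hom] (f : Z ⟶ W) [IsSeparated f.left]
    (h : Function.Injective fun p : Points Z ↦ p ≫ f) :
    UniversallyInjective f.left := by
  rw [UniversallyInjective.iff_diagonal]
  refine ⟨Set.range_eq_univ.mp ?_⟩
  have : LocallyOfFiniteType f.left :=
    have : LocallyOfFiniteType (f.left ≫ W.hom) := by rw [Over.w]; infer_instance
    locallyOfFiniteType_of_comp f.left W.hom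
  let P : SchC := Over.mk (pullback.fst f.left f.left ≫ Z.hom)
  have : LocallyOfFiniteType P.hom := by dsimp [P]; infer_instance
  refine eq_univ_of_forall_pt_mem (Z := P)
    (pullback.diagonal f.left).isClosedMap.isClosed_range.isOpen_compl.isLocallyClosed fun p ↦ ?_
  let fst : P ⟶ Z := Over.homMk (pullback.fst f.left f.left)
  let snd : P ⟶ Z := Over.homMk (pullback.snd f.left f.left) (by
    dsimp [P]; rw [← Over.w f, pullback.condition_assoc])
  have hp : p ≫ fst = p ≫ snd := h <| by
    dsimp only
    simp only [Category.assoc]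
    congr 1
    ext1
    exact pullback.condition
  have hp' : p.left ≫ pullback.fst f.left f.left = p.left ≫ pullback.snd f.left f.left :=
    congr(($hp).left)
  refine ⟨Points.pt (p ≫ fst), ?_⟩
  have hd : (p ≫ fst).left ≫ pullback.diagonal f.left = p.left := by
    apply pullback.hom_ext <;> simp [fst, hp']
  exact congr($hd (IsLocalRing.closedPoint ℂ))

/-- A proper morphism of complex schemes of finite type with finite fibres over complex points
is finite. -/
lemma isFinite_of_finite_fibers {Z W : SchC} [LocallyOfFiniteType Z.hom]
    [LocallyOfFiniteType W.hom] (f : Z ⟶ W) [IsProper f.left]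
    (h : ∀ w : Points W, {p : Points Z | p ≫ f = w}.Finite) : IsFinite f.left := by
  have := jacobsonSpace Z
  have key (w : Points W) : (f.left ⁻¹' {w.pt}).Finite := by
    have hcl : IsClosed (f.left ⁻¹' {w.pt}) := w.isClosed_pt.preimage f.left.continuous
    have hfin : (f.left ⁻¹' {w.pt} ∩ closedPoints Z.left).Finite := by
      refine ((h w).image Points.pt).subset ?_
      rintro z ⟨hzw, hz⟩
      obtain ⟨p, rfl⟩ := Points.exists_pt_eq hz
      exact ⟨p, Points.pt_injective W (by simpa using hzw), rfl⟩
    -- Finitely many closed points form a closed set, and closed points are dense in the closed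
    -- fibre, so the fibre consists of these points only.
    have hcl' : IsClosed (f.left ⁻¹' {w.pt} ∩ closedPoints Z.left) := by
      rw [← Set.biUnion_of_singleton (f.left ⁻¹' {w.pt} ∩ closedPoints Z.left)]
      exact hfin.isClosed_biUnion fun z hz ↦ hz.2
    rwa [← closure_inter_closedPoints hcl, hcl'.closure_eq]
  have : LocallyQuasiFinite f.left := by
    rw [← Scheme.Hom.quasiFiniteLocus_eq_top_iff]
    refine TopologicalSpace.Opens.ext (eq_univ_of_forall_pt_mem
      f.left.quasiFiniteLocus.isOpen.isClosed_compl.isLocallyClosed fun p ↦ ?_)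
    have hfin := key (p ≫ f)
    rw [Points.pt_comp] at hfin
    have : Finite (f.left.fiber (f.left p.pt)) :=
      (f.left.fiberHomeo (f.left p.pt)).finite_iff.mpr hfin
    -- The scheme-theoretic fibre is finite and locally of finite type over a field, hence discrete.
    exact Scheme.Hom.quasiFiniteAt_iff_isOpen_singleton_asFiber.mpr (isOpen_discrete _)
  exact .of_isProper_of_locallyQuasiFinite _

/-! ### Birational integral morphisms and normalization -/

/-- Integral closedness of a domain can be tested on localizations at maximal ideals, which here are
stalks of `X`. -/
lemma isIntegrallyClosed_of_isAffineOpen {X : Scheme.{0}} [IsIntegral X] (hX : IsNormalScheme X)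
    {V : X.Opens} (hV : IsAffineOpen V) [Nonempty V] : IsIntegrallyClosed Γ(X, V) := by
  let y (P : Ideal Γ(X, V)) (hP : P.IsPrime) : X := hV.fromSpec ⟨P, hP⟩
  have hy (P : Ideal Γ(X, V)) (hP : P.IsPrime) : y P hP ∈ V := (hV.isoSpec.inv _).2
  let inst (P : Ideal Γ(X, V)) [hP : P.IsMaximal] :
      Algebra Γ(X, V) (X.presheaf.stalk (y P hP.isPrime)) :=
    X.presheaf.algebra_section_stalk ⟨y P hP.isPrime, hy P hP.isPrime⟩
  have (P : Ideal Γ(X, V)) [hP : P.IsMaximal] :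
      IsLocalization.AtPrime (X.presheaf.stalk (y P hP.isPrime)) P :=
    hV.isLocalization_stalk' ⟨P, hP.isPrime⟩ (hy P hP.isPrime)
  exact @IsIntegrallyClosed.of_isLocalization_maximal _ _
    (fun P hP ↦ X.presheaf.stalk (y P hP.isPrime)) _ inst this _
    fun P hP ↦ (hX _).2

lemma germ_genericPoint_surjective_of_isIntegralElem {X : Scheme.{0}} [IsIntegral X]
    (hX : IsNormalScheme X) {V : X.Opens} (hV : IsAffineOpen V) [Nonempty V]
    (k : X.functionField) (hk : (X.germToFunctionField V).hom.IsIntegralElem k) :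
    ∃ a, X.germToFunctionField V a = k := by
  have := isIntegrallyClosed_of_isAffineOpen hX hV
  have := functionField_isFractionRing_of_isAffineOpen X V hV
  exact IsIntegrallyClosed.isIntegral_iff.mp hk

lemma fromSpecStalk_appLE {X : Scheme.{0}} {V : X.Opens} {x : X} (hV : x ∈ V)
    (h : ⊤ ≤ X.fromSpecStalk x ⁻¹ᵁ V) :
    (X.fromSpecStalk x).appLE V ⊤ h ≫ (Scheme.ΓSpecIso (X.presheaf.stalk x)).hom =
      X.presheaf.germ V x hV := by
  rw [Scheme.Hom.appLE, Scheme.fromSpecStalk_app hV, Category.assoc, Category.assoc, Category.assoc,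
    ← Functor.map_comp_assoc]
  have hid : (Spec (X.presheaf.stalk x)).presheaf.map
      ((homOfLE le_top).op ≫ (homOfLE h).op) = 𝟙 _ := CategoryTheory.Functor.map_id _ _
  rw [hid, Category.id_comp, Iso.inv_hom_id, Category.comp_id]

/-- An integral morphism to a normal integral scheme through which the generic point of the target
factors scheme-theoretically densely is an isomorphism. -/
lemma isIso_of_isNormalScheme {X T : Scheme.{0}} [IsIntegral X] (hX : IsNormalScheme X)
    (f : T ⟶ X) [IsIntegralHom f] (j : Spec X.functionField ⟶ T)
    [IsSchemeTheoreticallyDominant j] [QuasiCompact j] (hj : j ≫ f = fromGeneric X) :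
    IsIso f := by
  refine (IsZariskiLocalAtTarget.iff_of_iSup_eq_top (P := .isomorphisms _) _
    (iSup_affineOpens_eq_top X)).mpr fun ⟨V, hV⟩ ↦ ?_
  refine (isIso_morphismRestrict_iff_isIso_app f hV).mpr ?_
  rw [ConcreteCategory.isIso_iff_bijective]
  rcases isEmpty_or_nonempty V with hemp | hne
  · have : V = ⊥ := by
      ext x
      simpa using fun hx ↦ hemp.false ⟨x, hx⟩
    subst this
    have : Subsingleton Γ(X, ⊥) := inferInstance
    have : Subsingleton Γ(T, f ⁻¹ᵁ ⊥) := (f.app ⊥).hom.codomain_trivial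
    exact ⟨fun _ _ _ ↦ Subsingleton.elim _ _, fun b ↦ ⟨0, Subsingleton.elim _ _⟩⟩
  have hξ : genericPoint X ∈ V :=
    ((genericPoint_spec X).mem_open_set_iff V.isOpen).mpr (by simpa using hne)
  have htop : (⊤ : (Spec X.functionField).Opens) ≤ j ⁻¹ᵁ f ⁻¹ᵁ V := fun x _ ↦ by
    have hx : fromGeneric X x = genericPoint X := by
      have : Subsingleton (Spec X.functionField) :=
        inferInstanceAs (Subsingleton (PrimeSpectrum X.functionField))
      rw [Subsingleton.elim x (IsLocalRing.closedPoint _)]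
      exact X.fromSpecStalk_closedPoint
    rw [← hj, Scheme.Hom.comp_apply] at hx
    exact (congrArg (· ∈ V) hx).mpr hξ
  -- Restriction of sections along `j`: injective because `j` is scheme-theoretically dominant, and
  -- compatible with taking germs at the generic point of `X`.
  let ψ : Γ(T, f ⁻¹ᵁ V) ⟶ X.functionField :=
    j.appLE (f ⁻¹ᵁ V) ⊤ htop ≫ (Scheme.ΓSpecIso X.functionField).hom
  have hψ : Function.Injective ψ := by
    have h1 : Function.Injective (j.appLE (f ⁻¹ᵁ V) ⊤ htop) := by
      have hiso : IsIso ((Spec X.functionField).presheaf.map (homOfLE htop).op) := by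
        have : homOfLE htop = eqToHom (top_le_iff.mp htop).symm := Subsingleton.elim _ _
        rw [this]
        infer_instance
      rw [Scheme.Hom.appLE]
      exact ((ConcreteCategory.isIso_iff_bijective _).mp hiso).1.comp (j.app_injective _)
    exact ((ConcreteCategory.isIso_iff_bijective
      (Scheme.ΓSpecIso X.functionField).hom).mp inferInstance).1.comp h1
  have hfψ : f.app V ≫ ψ = X.germToFunctionField V := by
    have h1 : f.app V ≫ j.appLE (f ⁻¹ᵁ V) ⊤ htop = (j ≫ f).appLE V ⊤ htop := by
      rw [Scheme.Hom.app_eq_appLE, Scheme.Hom.appLE_comp_appLE]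
    have h2 : (j ≫ f).appLE V ⊤ htop = (fromGeneric X).appLE V ⊤ (by rw [← hj]; exact htop) := by
      congr 1
    rw [← Category.assoc, h1, h2]
    exact fromSpecStalk_appLE hξ _
  have hcomp (a : Γ(X, V)) : ψ (f.app V a) = X.germToFunctionField V a :=
    congr($hfψ a)
  refine ⟨fun a a' h ↦ X.germToFunctionField_injective V ?_, fun b ↦ ?_⟩
  · rw [← hcomp, ← hcomp, h]
  · have hb : (f.app V).hom.IsIntegralElem b := IsIntegralHom.isIntegral_app f V hV b
    -- Surjectivity: `ψ b` is integral over `Γ(X, V)`, hence the germ of a section `a` by normality,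
    -- and injectivity of `ψ` forces `b` to be the image of `a`.
    have hk : (X.germToFunctionField V).hom.IsIntegralElem (ψ b) := by
      rw [← hfψ]
      exact hb.map ψ.hom
    obtain ⟨a, ha⟩ := germ_genericPoint_surjective_of_isIntegralElem hX hV _ hk
    exact ⟨a, hψ ((hcomp a).trans ha)⟩

instance (X : Scheme.{0}) [IsIntegral X] : IsSchemeTheoreticallyDominant (fromGeneric X) :=
  have : IsDominant (fromGeneric X) := by
    refine ⟨dense_iff_closure_eq.mpr (Set.eq_univ_of_univ_subset ?_)⟩
    rw [← genericPoint_closure (α := X)]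
    refine closure_mono (Set.singleton_subset_iff.mpr ?_)
    exact ⟨_, X.fromSpecStalk_closedPoint⟩
  .of_isDominant _

lemma exists_iso_functionField {X Y : Scheme.{0}} [IsIntegral X] [IsIntegral Y] (f : X ⟶ Y)
    (hf : f (genericPoint X) = genericPoint Y) [IsIso (f.stalkMap (genericPoint X))] :
    ∃ e : Spec X.functionField ≅ Spec Y.functionField,
      e.hom ≫ fromGeneric Y = fromGeneric X ≫ f := by
  have : IsIso (Spec.map (f.stalkMap (genericPoint X))) := inferInstance
  unfold fromGeneric Scheme.functionField
  rw [← hf]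
  exact ⟨asIso (Spec.map (f.stalkMap (genericPoint X))), Scheme.SpecMap_stalkMap_fromSpecStalk f⟩

/-- A birational integral morphism from a normal integral scheme is the normalization of its
target. -/
lemma isNormalizationMap_of_birational {X Y : Scheme.{0}} [IsIntegral X] [IsIntegral Y]
    (hX : IsNormalScheme X) (f : X ⟶ Y) [IsIntegralHom f]
    (hf : f (genericPoint X) = genericPoint Y) [IsIso (f.stalkMap (genericPoint X))] :
    IsNormalizationMap f := by
  obtain ⟨e, he⟩ := exists_iso_functionField f hf
  have H : fromGeneric Y = (e.inv ≫ fromGeneric X) ≫ f := by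
    rw [Category.assoc, ← he, Iso.inv_hom_id_assoc]
  let d := (fromGeneric Y).normalizationDesc (e.inv ≫ fromGeneric X) f H
  have : IsSchemeTheoreticallyDominant (fromGeneric Y).toNormalization :=
    ⟨(fromGeneric Y).ker_toNormalization⟩
  -- The comparison map goes from the normalization to `X`, so it is the normality of `X` that makes
  -- it invertible.
  have : IsIso d := isIso_of_isNormalScheme hX d (e.hom ≫ (fromGeneric Y).toNormalization)
    (by simp [d])
  refine ⟨inferInstance, (asIso d).symm, ?_⟩
  exact (IsIso.inv_comp_eq d).mpr ((fromGeneric Y).normalizationDesc_comp _ f H).symm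

/-- A birational integral morphism from an integral scheme to a normal integral scheme is an
isomorphism. -/
lemma isIso_of_birational {X Y : Scheme.{0}} [IsIntegral X] [IsIntegral Y]
    (hY : IsNormalScheme Y) (f : X ⟶ Y) [IsIntegralHom f]
    (hf : f (genericPoint X) = genericPoint Y) [IsIso (f.stalkMap (genericPoint X))] :
    IsIso f := by
  obtain ⟨e, he⟩ := exists_iso_functionField f hf
  exact isIso_of_isNormalScheme hY f (e.inv ≫ fromGeneric X) (by
    rw [Category.assoc, ← he, Iso.inv_hom_id_assoc])

lemma isField_stalk_genericPoint (X : Scheme.{0}) [IsIntegral X] :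
    IsField (X.presheaf.stalk (genericPoint X)) :=
  Field.toIsField X.functionField

lemma isIso_residue_of_isField {X : Scheme.{0}} {x : X} (hx : IsField (X.presheaf.stalk x)) :
    IsIso (X.residue x) := by
  rw [ConcreteCategory.isIso_iff_bijective]
  let := hx.toField
  exact ⟨RingHom.injective (X.residue x).hom, X.residue_surjective x⟩

/-- Stalks at generic points are their own residue fields. Universal injectivity makes the residue
field extension purely inseparable, and `g` puts it in characteristic zero, where such an extension
is trivial. -/
lemma isIso_stalkMap_of_universallyInjective {X Y : Scheme.{0}} [IsIntegral X] [IsIntegral Y]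
    (g : Y ⟶ Spec (CommRingCat.of ℂ)) (f : X ⟶ Y) [UniversallyInjective f]
    (hf : f (genericPoint X) = genericPoint Y) : IsIso (f.stalkMap (genericPoint X)) := by
  set x := genericPoint X with hx
  have := isIso_residue_of_isField (isField_stalk_genericPoint X)
  have : IsIso (Y.residue (f x)) := isIso_residue_of_isField (by
    rw [hf]; exact isField_stalk_genericPoint Y)
  have hpi : (f.residueFieldMap x).hom.IsPurelyInseparable :=
    (((tfae_universallyInjective f).out 0 2 rfl rfl).mp ‹_›).2 x
  have : CharZero (Y.residueField (f x)) := charZero_of_injective_ringHom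
    (Spec.preimage (Y.fromSpecResidueField (f x) ≫ g)).hom.injective
  have : IsIso (f.residueFieldMap x) := by
    rw [ConcreteCategory.isIso_iff_bijective]
    algebraize [(f.residueFieldMap x).hom]
    have : IsPurelyInseparable (Y.residueField (f x)) (X.residueField x) := hpi
    exact IsPurelyInseparable.bijective_algebraMap_of_isSeparable _ _
  have h := Scheme.residue_residueFieldMap f x
  have h2 : f.stalkMap x = (Y.residue (f x) ≫ f.residueFieldMap x) ≫ inv (X.residue x) := by
    rw [h]; simp
  rw [h2]
  infer_instance

/-! ### Schemes covered by affine spaces -/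

/-- The affine space over `ℂ` with coordinates indexed by `σ`. -/
def affineSpace (σ : Type) : SchC :=
  Over.mk (𝔸(σ; Spec (CommRingCat.of ℂ)) ↘ Spec (CommRingCat.of ℂ))

/-- `Z` is covered by open subschemes isomorphic to affine spaces, all of which contain `p`. -/
def HasAffineSpaceCover (σ : Type) (Z : SchC) (p : Points Z) : Prop :=
  ∀ z : Z.left, ∃ g : affineSpace σ ⟶ Z,
    IsOpenImmersion g.left ∧ z ∈ Set.range g.left ∧ p.pt ∈ Set.range g.left

lemma isNormalScheme_of_isOpenImmersion {X : Scheme.{0}}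
    (h : ∀ x : X, ∃ (W : Scheme.{0}) (g : W ⟶ X),
      IsOpenImmersion g ∧ x ∈ Set.range g ∧ IsNormalScheme W) :
    IsNormalScheme X := by
  intro x
  obtain ⟨W, g, hg, ⟨w, rfl⟩, hW⟩ := h x
  let e : W.presheaf.stalk w ≃+* X.presheaf.stalk (g w) :=
    (asIso (g.stalkMap w)).symm.commRingCatIsoToRingEquiv
  have := (hW w).1
  have := (hW w).2
  exact ⟨e.symm.toMulEquiv.isDomain _, IsIntegrallyClosed.of_equiv e⟩

lemma isNormalScheme_spec (R : CommRingCat.{0}) [IsDomain R] [IsIntegrallyClosed R] :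
    IsNormalScheme (Spec R) := by
  intro x
  have : x.asIdeal.IsPrime := PrimeSpectrum.isPrime x
  let e : Localization.AtPrime x.asIdeal ≃+* (Spec R).presheaf.stalk x :=
    (Spec.stalkIso R x).symm.commRingCatIsoToRingEquiv
  have hle : x.asIdeal.primeCompl ≤ nonZeroDivisors R := x.asIdeal.primeCompl_le_nonZeroDivisors
  have : IsDomain (Localization.AtPrime x.asIdeal) := IsLocalization.isDomain_localization hle
  have : IsIntegrallyClosed (Localization.AtPrime x.asIdeal) :=
    isIntegrallyClosed_of_isLocalization _ x.asIdeal.primeCompl hle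
  exact ⟨e.symm.toMulEquiv.isDomain _, IsIntegrallyClosed.of_equiv e⟩

lemma isNormalScheme_affineSpace (σ : Type) [Finite σ] : IsNormalScheme (affineSpace σ).left := by
  have hinv : IsOpenImmersion (AffineSpace.SpecIso σ (CommRingCat.of ℂ)).inv := inferInstance
  refine isNormalScheme_of_isOpenImmersion fun x ↦
    ⟨_, (AffineSpace.SpecIso σ (CommRingCat.of ℂ)).inv, hinv, ?_, ?_⟩
  · exact (AffineSpace.SpecIso σ (CommRingCat.of ℂ)).inv.surjective x
  · have : IsIntegrallyClosed (MvPolynomial σ ℂ) := inferInstance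
    have : IsDomain (MvPolynomial σ ℂ) := inferInstance
    exact isNormalScheme_spec (CommRingCat.of (MvPolynomial σ ℂ))

instance (σ : Type) : IsIntegral (affineSpace σ).left :=
  inferInstanceAs (IsIntegral 𝔸(σ; Spec (CommRingCat.of ℂ)))

namespace HasAffineSpaceCover

variable {σ : Type} {Z : SchC} {p : Points Z}

lemma isNormalScheme [Finite σ] (h : HasAffineSpaceCover σ Z p) : IsNormalScheme Z.left :=
  isNormalScheme_of_isOpenImmersion fun z ↦
    have ⟨g, hg, hz, _⟩ := h z
    ⟨_, g.left, hg, hz, isNormalScheme_affineSpace σ⟩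

/-- Stalks are domains, which gives reducedness. Charts are irreducible and any two meet at `p`,
which gives irreducibility. -/
lemma isIntegral [Finite σ] (h : HasAffineSpaceCover σ Z p) : IsIntegral Z.left := by
  have hred : IsReduced Z.left :=
    have (z : Z.left) : _root_.IsReduced (Z.left.presheaf.stalk z) :=
      have := (h.isNormalScheme z).1
      inferInstance
    isReduced_of_isReduced_stalk _
  have hirr : IrreducibleSpace Z.left := by
    have : Nonempty Z.left := ⟨p.pt⟩
    have : PreirreducibleSpace Z.left := by
      refine ⟨fun U V hU hV ⟨u, _, hu⟩ ⟨v, _, hv⟩ ↦ ?_⟩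
      obtain ⟨g, hg, hgu, hgp⟩ := h u
      obtain ⟨g', hg', hgv, hgp'⟩ := h v
      have hir (g : affineSpace σ ⟶ Z) : IsPreirreducible (Set.range g.left) := by
        rw [← Set.image_univ]
        exact (PreirreducibleSpace.isPreirreducible_univ).image _ g.left.continuous.continuousOn
      -- Inside the chart `g`, the open `U` meets the chart `g'`; inside `g'` it then meets `V`.
      obtain ⟨x, hxg, hxU, hxg'⟩ := hir g U (Set.range g'.left) hU
        g'.left.isOpenEmbedding.isOpen_range ⟨u, hgu, hu⟩ ⟨_, hgp, hgp'⟩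
      obtain ⟨y, hyg, hy⟩ := hir g' U V hU hV ⟨x, hxg', hxU⟩ ⟨v, hgv, hv⟩
      exact ⟨y, trivial, hy⟩
    exact ⟨inferInstance⟩
  exact isIntegral_of_irreducibleSpace_of_isReduced _

end HasAffineSpaceCover

/-! ### Products of affine space charts -/

/-- The projection of `X ^ n` to its `i`-th factor. -/
def powerProj (X : SchC) {n : ℕ} (i : Fin n) : power X n ⟶ X :=
  Pi.π (fun _ : Fin n ↦ X) i

lemma power_hom_ext {X T : SchC} {n : ℕ} {f g : T ⟶ power X n}
    (h : ∀ i, f ≫ powerProj X i = g ≫ powerProj X i) : f = g :=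
  Pi.hom_ext _ _ h

lemma tuple_powerProj {X : SchC} {n : ℕ} (x : Fin n → Points X) (i : Fin n) :
    tuple x ≫ powerProj X i = x i :=
  Pi.lift_π _ _

lemma exists_eq_tuple {X : SchC} {n : ℕ} (p : Points (power X n)) :
    ∃ x : Fin n → Points X, p = tuple x :=
  ⟨fun i ↦ p ≫ powerProj X i, power_hom_ext fun i ↦ (tuple_powerProj (fun i ↦ p ≫ powerProj X i) i).symm⟩

lemma tuple_injective {X : SchC} {n : ℕ} : Function.Injective (tuple (X := X) (n := n)) :=
  fun x y h ↦ funext fun i ↦ by rw [← tuple_powerProj x, h, tuple_powerProj]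

lemma powerProj_pt_tuple {X : SchC} {n : ℕ} (x : Fin n → Points X) (i : Fin n) :
    (powerProj X i).left (tuple x).pt = (x i).pt := by
  rw [← Points.pt_comp, tuple_powerProj]

section chart

variable {σ : Type} {X : SchC} {n : ℕ} (g : Fin n → (affineSpace σ ⟶ X))
  [∀ i, IsOpenImmersion (g i).left]

/-- The open subset of `X ^ n` whose `i`-th coordinate lies in the image of the chart `g i`. -/
def chartOpen : (power X n).left.Opens :=
  ⟨⋂ i, (powerProj X i).left ⁻¹' Set.range (g i).left, isOpen_iInter_of_finite fun i ↦
    (g i).left.isOpenEmbedding.isOpen_range.preimage (powerProj X i).left.continuous⟩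

lemma mem_chartOpen {z : (power X n).left} :
    z ∈ chartOpen g ↔ ∀ i, (powerProj X i).left z ∈ Set.range (g i).left :=
  Set.mem_iInter

/-- The open subset `chartOpen g` as a complex scheme. -/
def chartScheme : SchC := Over.mk ((chartOpen g).ι ≫ (power X n).hom)

/-- The inclusion of `chartOpen g`. -/
def chartι : chartScheme g ⟶ power X n := Over.homMk (chartOpen g).ι

instance : IsOpenImmersion (chartι g).left :=
  inferInstanceAs (IsOpenImmersion (chartOpen g).ι)

lemma range_chartι : Set.range (chartι g).left = chartOpen g :=
  (chartOpen g).range_ι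

lemma mono_of_isOpenImmersion {Z W : SchC} (f : Z ⟶ W) [IsOpenImmersion f.left] : Mono f :=
  Over.mono_of_mono_left f

/-- A morphism over `ℂ` whose image lies in the image of an open immersion factors through it. -/
lemma exists_lift_of_isOpenImmersion {Z W T : SchC} (f : Z ⟶ W) [IsOpenImmersion f.left]
    (t : T ⟶ W) (h : Set.range t.left ⊆ Set.range f.left) : ∃ s : T ⟶ Z, s ≫ f = t :=
  ⟨Over.homMk (IsOpenImmersion.lift f.left t.left h) (by
    rw [← Over.w f, IsOpenImmersion.lift_fac_assoc, Over.w]), by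
    ext1; exact IsOpenImmersion.lift_fac f.left t.left h⟩

/-- The coordinate projection from the `n`-fold product of an affine space. -/
def affineSpaceProj (i : Fin n) : affineSpace (Fin n × σ) ⟶ affineSpace σ :=
  Over.homMk (AffineSpace.reindex (fun s ↦ (i, s)) _) (AffineSpace.reindex_over _ _)

lemma affineSpace_hom_ext {T : SchC} {f f' : T ⟶ affineSpace (Fin n × σ)}
    (h : ∀ i, f ≫ affineSpaceProj i = f' ≫ affineSpaceProj i) : f = f' := by
  ext1
  refine AffineSpace.hom_ext ((Over.w f).trans (Over.w f').symm) fun ⟨i, s⟩ ↦ ?_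
  have hs := AffineSpace.reindex_appTop_coord (fun s : σ ↦ (i, s)) (Spec (CommRingCat.of ℂ)) s
  have hf (f : T ⟶ affineSpace (Fin n × σ)) :
      f.left.appTop (AffineSpace.coord _ (i, s)) =
        (f ≫ affineSpaceProj i).left.appTop (AffineSpace.coord _ s) := by
    rw [← hs]
    exact congr($((Scheme.Hom.comp_appTop f.left
      (AffineSpace.reindex (fun s : σ ↦ (i, s)) (Spec (CommRingCat.of ℂ)))).symm) _)
  refine (hf f).trans (Eq.trans ?_ (hf f').symm)
  rw [h i]

/-- Together with `affineSpace_hom_ext`, this is the universal property of `affineSpace (Fin n × σ)`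
as an `n`-fold product. -/
lemma exists_affineSpace_lift {T : SchC} (f : Fin n → (T ⟶ affineSpace σ)) :
    ∃ F : T ⟶ affineSpace (Fin n × σ), ∀ i, F ≫ affineSpaceProj i = f i := by
  let v : Fin n × σ → Γ(T.left, ⊤) := fun a ↦ (f a.1).left.appTop (AffineSpace.coord _ a.2)
  refine ⟨Over.homMk (AffineSpace.homOfVector T.hom v) (AffineSpace.homOfVector_over _ _),
    fun i ↦ ?_⟩
  ext1
  refine AffineSpace.hom_ext ((Over.w (_ ≫ _)).trans (Over.w (f i)).symm) fun s ↦ ?_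
  have h1 := congr($(Scheme.Hom.comp_appTop (AffineSpace.homOfVector T.hom v)
      (AffineSpace.reindex (fun s : σ ↦ (i, s)) (Spec (CommRingCat.of ℂ)))) (AffineSpace.coord _ s))
  refine h1.trans ?_
  refine (congrArg _ (AffineSpace.reindex_appTop_coord (fun s : σ ↦ (i, s)) _ s)).trans ?_
  exact AffineSpace.homOfVector_appTop_coord _ _ (i, s)

/-- Maps into either the affine space or `chartScheme g` amount to `n`-tuples of maps into
`affineSpace σ`; the resulting maps `fwd` and `back` are mutually inverse. -/
lemma exists_power_chart : ∃ G : affineSpace (Fin n × σ) ⟶ power X n,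
    IsOpenImmersion G.left ∧ Set.range G.left = chartOpen g := by
  have hmono (i : Fin n) := mono_of_isOpenImmersion (g i)
  have := mono_of_isOpenImmersion (chartι g)
  have hproj (i : Fin n) : ∃ s : chartScheme g ⟶ affineSpace σ,
      s ≫ g i = chartι g ≫ powerProj X i := by
    refine exists_lift_of_isOpenImmersion (g i) _ ?_
    rintro _ ⟨z, rfl⟩
    have hz : (chartι g).left z ∈ chartOpen g := (range_chartι g).le (Set.mem_range_self z)
    exact (mem_chartOpen g).mp hz i
  choose proj hproj using hproj
  obtain ⟨fwd, hfwd⟩ := exists_affineSpace_lift proj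
  let G : affineSpace (Fin n × σ) ⟶ power X n := Pi.lift fun i ↦ affineSpaceProj i ≫ g i
  have hG (i : Fin n) : G ≫ powerProj X i = affineSpaceProj i ≫ g i := Pi.lift_π _ _
  obtain ⟨back, hback⟩ : ∃ s : affineSpace (Fin n × σ) ⟶ chartScheme g, s ≫ chartι g = G := by
    refine exists_lift_of_isOpenImmersion (chartι g) G ?_
    rw [range_chartι]
    rintro _ ⟨z, rfl⟩
    refine (mem_chartOpen g).mpr fun i ↦ ?_
    have h := congr(($(hG i)).left z)
    exact ⟨(affineSpaceProj i).left z, h.symm⟩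
  have h1 : back ≫ fwd = 𝟙 _ := affineSpace_hom_ext fun i ↦ by
    rw [Category.assoc, hfwd, ← cancel_mono (g i), Category.assoc, hproj, reassoc_of% hback, hG,
      Category.id_comp]
  have h2 : fwd ≫ back = 𝟙 _ := by
    rw [← cancel_mono (chartι g), Category.assoc, hback, Category.id_comp]
    refine power_hom_ext fun i ↦ ?_
    rw [Category.assoc, hG, reassoc_of% (hfwd i), hproj]
  let e : affineSpace (Fin n × σ) ≅ chartScheme g := ⟨back, fwd, h1, h2⟩
  have : IsIso back.left := inferInstanceAs (IsIso ((Over.forget _).mapIso e).hom)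
  refine ⟨G, ?_, ?_⟩
  · rw [← hback, Over.comp_left]
    infer_instance
  · rw [← range_chartι g, ← hback]
    change Set.range (⇑(chartι g).left ∘ ⇑back.left) = _
    exact back.left.surjective.range_comp _

end chart

lemma HasAffineSpaceCover.power {σ : Type} {X : SchC} {p : Points X}
    (h : HasAffineSpaceCover σ X p) (n : ℕ) :
    HasAffineSpaceCover (Fin n × σ) (power X n) (tuple fun _ ↦ p) := by
  intro z
  choose g hg hz hp using fun i ↦ h ((powerProj X i).left z)
  obtain ⟨G, hG, hr⟩ := exists_power_chart g
  refine ⟨G, hG, ?_, ?_⟩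
  · rw [hr]
    exact (mem_chartOpen g).mpr hz
  · rw [hr]
    exact (mem_chartOpen g).mpr fun i ↦ by rw [powerProj_pt_tuple]; exact hp i

section projectiveSpace

/-! ### Standard charts of projective space -/

open MvPolynomial HomogeneousLocalization

lemma eval₂_mul_of_isHomogeneous {σ R S : Type*} [CommSemiring R] [CommSemiring S]
    {a : MvPolynomial σ R} {d : ℕ} (ha : a.IsHomogeneous d) (f : R →+* S) (u : S) (v : σ → S) :
    eval₂ f (fun k ↦ u * v k) a = u ^ d * eval₂ f v a := by
  rw [eval₂_eq, eval₂_eq, Finset.mul_sum]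
  refine Finset.sum_congr rfl fun b hb ↦ ?_
  have hd : ∑ k ∈ b.support, b k = d := by
    have := ha (mem_support_iff.mp hb)
    simpa [Finsupp.weight_apply, Finsupp.sum] using this
  simp_rw [mul_pow, Finset.prod_mul_distrib]
  rw [Finset.prod_pow_eq_pow_sum, hd, mul_left_comm]

attribute [local instance] MvPolynomial.gradedAlgebra

/-- The grading of `ℂ[x₀, …, xₘ]` by degree. -/
abbrev polyGrading (m : ℕ) : ℕ → Submodule ℂ (MvPolynomial (Fin (m + 1)) ℂ) :=
  homogeneousSubmodule (Fin (m + 1)) ℂ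

section chartRing

variable {m : ℕ} (i : Fin (m + 1))

/-- Setting the variable `xᵢ` to `1`. -/
def dehomogenize : MvPolynomial (Fin (m + 1)) ℂ →+* MvPolynomial (Fin m) ℂ :=
  eval₂Hom C (i.insertNth (α := fun _ ↦ MvPolynomial (Fin m) ℂ) 1 X)

lemma dehomogenize_X_self : dehomogenize i (X i) = 1 := by
  simp [dehomogenize]

lemma dehomogenize_X_succAbove (j : Fin m) : dehomogenize i (X (i.succAbove j)) = X j := by
  simp [dehomogenize]

/-- The ring of functions on `D₊(xᵢ)`. -/
abbrev chartRing : Type := Away (polyGrading m) (X i)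

lemma X_mem_polyGrading (i : Fin (m + 1)) : (X i : MvPolynomial (Fin (m + 1)) ℂ) ∈ polyGrading m 1 :=
  isHomogeneous_X ℂ i

/-- Dehomogenization `p / xᵢ ^ d ↦ p(…, 1, …)` on the chart ring. -/
def chartRingToPoly : chartRing i →+* MvPolynomial (Fin m) ℂ :=
  (Localization.awayLift (dehomogenize i) (X i)
    (by rw [dehomogenize_X_self]; exact isUnit_one)).comp (algebraMap _ _)

lemma chartRingToPoly_mk (d : ℕ) (a : MvPolynomial (Fin (m + 1)) ℂ) (ha) :
    chartRingToPoly i (Away.mk (polyGrading m) (X_mem_polyGrading i) d a ha) = dehomogenize i a := by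
  have h := Localization.awayLift_mk (dehomogenize i) (X i) a 1
    (by rw [dehomogenize_X_self, mul_one]) d
  exact h.trans (by rw [one_pow, mul_one])

/-- The constants in the chart ring. -/
def chartRingC : ℂ →+* chartRing i :=
  (fromZeroRingHom (polyGrading m) (Submonoid.powers (X i))).comp (algebraMap ℂ (polyGrading m 0))

lemma val_chartRingC (c : ℂ) :
    (chartRingC i c).val = algebraMap (MvPolynomial (Fin (m + 1)) ℂ)
      (Localization.Away (X i : MvPolynomial (Fin (m + 1)) ℂ)) (C c) :=
  Localization.mk_one_eq_algebraMap (C c)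

lemma chartRingToPoly_C (c : ℂ) : chartRingToPoly i (chartRingC i c) = C c := by
  rw [chartRingToPoly, RingHom.comp_apply, HomogeneousLocalization.algebraMap_apply, val_chartRingC]
  refine (IsLocalization.Away.lift_eq _ _ _).trans ?_
  simp [dehomogenize]

/-- The inverse `xⱼ ↦ xⱼ / xᵢ` of dehomogenization. -/
def polyToChartRing : MvPolynomial (Fin m) ℂ →+* chartRing i :=
  eval₂Hom (chartRingC i) fun j ↦
    Away.mk (polyGrading m) (X_mem_polyGrading i) 1 (X (i.succAbove j))
      (X_mem_polyGrading (i.succAbove j))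

lemma chartRingToPoly_comp_polyToChartRing :
    (chartRingToPoly i).comp (polyToChartRing i) = RingHom.id _ := by
  refine MvPolynomial.ringHom_ext (fun c ↦ ?_) fun j ↦ ?_
  · simp [polyToChartRing, chartRingToPoly_C]
  · simp [polyToChartRing, chartRingToPoly_mk, dehomogenize_X_succAbove]

lemma polyToChartRing_chartRingToPoly (x : chartRing i) :
    polyToChartRing i (chartRingToPoly i x) = x := by
  obtain ⟨d, a, ha, rfl⟩ := Away.mk_surjective (polyGrading m) (X_mem_polyGrading i) x
  rw [chartRingToPoly_mk]
  apply val_injective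
  rw [Away.val_mk, Localization.mk_eq_mk', eq_comm, IsLocalization.mk'_eq_iff_eq_mul]
  let θ : MvPolynomial (Fin (m + 1)) ℂ →+* Localization.Away (X i : MvPolynomial (Fin (m + 1)) ℂ) :=
    (algebraMap _ _).comp ((polyToChartRing i).comp (dehomogenize i))
  let κ := algebraMap (MvPolynomial (Fin (m + 1)) ℂ)
    (Localization.Away (X i : MvPolynomial (Fin (m + 1)) ℂ))
  change κ a = θ a * κ (X i ^ d)
  have ha' : a.IsHomogeneous d := by
    have := ha
    rwa [smul_eq_mul, mul_one] at this
  have hC (c : ℂ) : θ (C c) = κ (C c) := by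
    simp [θ, κ, dehomogenize, polyToChartRing, val_chartRingC]
  -- In the localization `x_k = x_i · θ(x_k)`, so homogeneity of degree `d` gives `a = x_i ^ d ·
  -- θ(a)`.
  have hX (k : Fin (m + 1)) : κ (X k) = κ (X i) * θ (X k) := by
    obtain rfl | ⟨j, rfl⟩ := Fin.eq_self_or_eq_succAbove i k
    · simp [θ, dehomogenize_X_self]
    · let u : Submonoid.powers (X i : MvPolynomial (Fin (m + 1)) ℂ) := ⟨X i ^ 1, 1, rfl⟩
      have : θ (X (i.succAbove j)) = Localization.mk (X (i.succAbove j)) u := by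
        simp [θ, u, dehomogenize_X_succAbove, polyToChartRing]
      have hu : κ (X i) = κ u := by simp [u]
      rw [this, mul_comm, Localization.mk_eq_mk', hu]
      exact (IsLocalization.mk'_spec _ _ u).symm
  have h := eval₂_mul_of_isHomogeneous ha' (κ.comp C) (κ (X i)) fun k ↦ θ (X k)
  have h1 : κ = eval₂Hom (κ.comp C) fun k ↦ κ (X i) * θ (X k) :=
    MvPolynomial.ringHom_ext (by simp) (by simp [← hX])
  have h2 : θ = eval₂Hom (κ.comp C) fun k ↦ θ (X k) :=
    MvPolynomial.ringHom_ext (by simp [hC]) (by simp)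
  rw [map_pow, mul_comm]
  calc κ a = _ := congr($h1 a)
    _ = _ := h
    _ = _ := by congr 1; exact congr($h2.symm a)

/-- The chart ring is a polynomial ring. -/
def chartRingEquiv : chartRing i ≃+* MvPolynomial (Fin m) ℂ :=
  RingEquiv.ofRingHom (chartRingToPoly i) (polyToChartRing i)
    (chartRingToPoly_comp_polyToChartRing i) (RingHom.ext (polyToChartRing_chartRingToPoly i))

instance : IsIso (Spec.map (CommRingCat.ofHom (chartRingToPoly i))) :=
  inferInstanceAs (IsIso (Scheme.Spec.mapIso (chartRingEquiv i).toCommRingCatIso.op).hom)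

/-- The isomorphism from affine space to the chart `D₊(xᵢ)`, followed by the inclusion. -/
def projChartHom : 𝔸(Fin m; Spec (CommRingCat.of ℂ)) ⟶ Proj (polyGrading m) :=
  ((AffineSpace.SpecIso (Fin m) (CommRingCat.of ℂ)).hom ≫
    Spec.map (CommRingCat.ofHom (chartRingToPoly i))) ≫
    Proj.awayι (polyGrading m) (X i) (X_mem_polyGrading i) one_pos

/-- The structure morphism of projective space. -/
def projStructureHom (m : ℕ) : Proj (polyGrading m) ⟶ Spec (CommRingCat.of ℂ) :=
  Proj.toSpecZero (polyGrading m) ≫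
    Spec.map (CommRingCat.ofHom (algebraMap ℂ (polyGrading m 0)))

lemma projChartHom_over : projChartHom i ≫ projStructureHom m =
    𝔸(Fin m; Spec (CommRingCat.of ℂ)) ↘ Spec (CommRingCat.of ℂ) := by
  have h : Proj.awayι (polyGrading m) (X i) (X_mem_polyGrading i) one_pos ≫ projStructureHom m =
      Spec.map (CommRingCat.ofHom (chartRingC i)) := by
    refine (Proj.awayι_toSpecZero_assoc _ _ _ _ _).trans ?_
    rw [← Spec.map_comp]
    rfl
  rw [projChartHom, Category.assoc, Category.assoc, h, ← Spec.map_comp, ← CommRingCat.ofHom_comp,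
    show (chartRingToPoly i).comp (chartRingC i) = C from RingHom.ext (chartRingToPoly_C i)]
  exact (Iso.eq_inv_comp _).mp (AffineSpace.SpecIso_inv_over _).symm

instance : IsOpenImmersion (projChartHom i) := by
  unfold projChartHom
  infer_instance

/-- The standard open immersion of affine space with image `D₊(xᵢ)`. -/
def projChart : affineSpace (Fin m) ⟶ projSpace m :=
  Over.homMk (projChartHom i) (projChartHom_over i)

instance : IsOpenImmersion (projChart i).left :=
  inferInstanceAs (IsOpenImmersion (projChartHom i))

lemma opensRange_projChartHom :
    (projChartHom i).opensRange = Proj.basicOpen (polyGrading m) (X i) :=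
  (Scheme.Hom.opensRange_comp_of_isIso _ _).trans (Proj.opensRange_awayι _ _ _ _)

lemma mem_range_projChart (z : Proj (polyGrading m)) :
    z ∈ Set.range (projChart i).left ↔ z ∈ Proj.basicOpen (polyGrading m) (X i) := by
  rw [← opensRange_projChartHom]
  rfl

end chartRing

lemma irrelevant_le_span_X (m : ℕ) :
    (HomogeneousIdeal.irrelevant (polyGrading m)).toIdeal ≤
      Ideal.span (Set.range (X : Fin (m + 1) → MvPolynomial (Fin (m + 1)) ℂ)) := by
  refine (HomogeneousIdeal.toIdeal_irrelevant_le _).mpr fun d hd a ha ↦ ?_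
  have h : a ∈ idealOfVars (Fin (m + 1)) ℂ ^ 1 := by
    refine (mem_pow_idealOfVars_iff 1 a).mpr fun x hx ↦ ?_
    by_contra hlt
    have hx' : x.degree ≠ d := by omega
    exact mem_support_iff.mp hx (IsHomogeneous.coeff_eq_zero ha hx')
  rwa [pow_one] at h

lemma iSup_basicOpen_X (m : ℕ) :
    ⨆ i, Proj.basicOpen (polyGrading m) (X i) = ⊤ :=
  Proj.iSup_basicOpen_eq_top _ _ (irrelevant_le_span_X m)

lemma algebraMap_polyGrading_zero_bijective (m : ℕ) :
    Function.Bijective (algebraMap ℂ (polyGrading m 0)) := by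
  refine ⟨fun c d h ↦ C_injective (Fin (m + 1)) ℂ congr(($h : MvPolynomial (Fin (m + 1)) ℂ)), fun ⟨a, ha⟩ ↦ ?_⟩
  have h : a ∈ (1 : Submodule ℂ (MvPolynomial (Fin (m + 1)) ℂ)) := by
    rw [← homogeneousSubmodule_zero]
    exact ha
  obtain ⟨c, hc⟩ := Submodule.mem_one.mp h
  exact ⟨c, Subtype.ext hc⟩

/-- `Proj` is proper over the spectrum of the degree-zero part, by finite generation, and that part
is `ℂ`. -/
instance (m : ℕ) : IsProper (projSpace m).hom := by
  have : IsScalarTower ℂ (polyGrading m 0) (MvPolynomial (Fin (m + 1)) ℂ) :=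
    ⟨fun c a x ↦ Algebra.smul_mul_assoc c (a : MvPolynomial (Fin (m + 1)) ℂ) x⟩
  have : Algebra.FiniteType (polyGrading m 0) (MvPolynomial (Fin (m + 1)) ℂ) :=
    Algebra.FiniteType.of_restrictScalars_finiteType ℂ _ _
  have : IsIso (Spec.map (CommRingCat.ofHom (algebraMap ℂ (polyGrading m 0)))) :=
    inferInstanceAs (IsIso (Scheme.Spec.mapIso (RingEquiv.ofBijective _
      (algebraMap_polyGrading_zero_bijective m)).toCommRingCatIso.op).hom)
  change IsProper (projStructureHom m)
  unfold projStructureHom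
  infer_instance

/-- Supplies the point common to all standard charts: one where no coordinate vanishes. -/
lemma basicOpen_prod_X_nonempty (m : ℕ) :
    (Proj.basicOpen (polyGrading m) (∏ i, X i) : Set (Proj (polyGrading m))).Nonempty := by
  have hdeg : (∏ i, X i : MvPolynomial (Fin (m + 1)) ℂ) ∈ polyGrading m (∑ _i : Fin (m + 1), 1) :=
    IsHomogeneous.prod _ _ _ fun i _ ↦ isHomogeneous_X ℂ i
  have hne : (∏ i, X i : MvPolynomial (Fin (m + 1)) ℂ) ≠ 0 :=
    Finset.prod_ne_zero_iff.mpr fun i _ ↦ X_ne_zero i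
  have : Nontrivial (Localization.Away (∏ i, X i : MvPolynomial (Fin (m + 1)) ℂ)) :=
    (IsLocalization.injective _ (powers_le_nonZeroDivisors_of_noZeroDivisors hne)).nontrivial
      (f := algebraMap (MvPolynomial (Fin (m + 1)) ℂ) _)
  have : Nontrivial (Away (polyGrading m) (∏ i, X i)) :=
    (algebraMap (Away (polyGrading m) (∏ i, X i))
      (Localization.Away (∏ i, X i : MvPolynomial (Fin (m + 1)) ℂ))).domain_nontrivial
  obtain ⟨z⟩ : Nonempty (PrimeSpectrum (Away (polyGrading m) (∏ i, X i))) := inferInstance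
  rw [← Proj.opensRange_awayι (polyGrading m) _ hdeg (by simp)]
  exact ⟨_, z, rfl⟩

lemma exists_hasAffineSpaceCover_projSpace (m : ℕ) :
    ∃ p, HasAffineSpaceCover (Fin m) (projSpace m) p := by
  obtain ⟨p, hp⟩ := Points.exists_pt_mem (Z := projSpace m)
    (Proj.basicOpen (polyGrading m) (∏ i, X i)).isOpen.isLocallyClosed
    (basicOpen_prod_X_nonempty m)
  refine ⟨p, fun z ↦ ?_⟩
  have hz : z ∈ ⨆ i, Proj.basicOpen (polyGrading m) (X i) := by
    rw [iSup_basicOpen_X]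
    trivial
  obtain ⟨i, hi⟩ := TopologicalSpace.Opens.mem_iSup.mp hz
  exact ⟨projChart i, inferInstance, (mem_range_projChart i z).mpr hi,
    (mem_range_projChart i p.pt).mpr (Proj.basicOpen_mono _ _ _
      (Finset.dvd_prod_of_mem _ (Finset.mem_univ i)) hp)⟩

end projectiveSpace

/-! ### Powers of proper schemes -/

lemma isProper_of_iso {Z W : SchC} (e : Z ≅ W) [IsProper W.hom] : IsProper Z.hom := by
  have : IsIso e.hom.left := inferInstanceAs (IsIso ((Over.forget _).mapIso e).hom)
  rw [← Over.w e.hom]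
  infer_instance

lemma isProper_prod (Z W : SchC) [IsProper Z.hom] [IsProper W.hom] : IsProper (Z ⨯ W).hom := by
  have h := Over.isPullback_of_binaryFan_isLimit _ (prodIsProd Z W)
  have : IsProper (prod.fst : Z ⨯ W ⟶ Z).left :=
    MorphismProperty.of_isPullback (P := @IsProper) h.flip ‹IsProper W.hom›
  rw [← Over.w (prod.fst : Z ⨯ W ⟶ Z)]
  infer_instance

lemma isProper_power (X : SchC) [IsProper X.hom] (n : ℕ) : IsProper (power X n).hom := by
  induction n with
  | zero =>
    have hT : IsTerminal (power X 0) :=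
      IsTerminal.ofUniqueHom (fun _ ↦ Pi.lift fun i ↦ i.elim0) fun _ _ ↦
        power_hom_ext fun i ↦ i.elim0
    have : IsProper (Over.mk (𝟙 (Spec (CommRingCat.of ℂ)))).hom :=
      inferInstanceAs (IsProper (𝟙 (Spec (CommRingCat.of ℂ))))
    exact isProper_of_iso (hT.uniqueUpToIso Over.mkIdTerminal)
  | succ n ih =>
    have := isProper_prod X (power X n)
    let e : power X (n + 1) ≅ X ⨯ power X n :=
      (productIsProduct fun _ : Fin (n + 1) ↦ X).conePointUniqueUpToIso
        (extendFanIsLimit (fun _ : Fin (n + 1) ↦ X) (productIsProduct fun _ : Fin n ↦ X)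
          (prodIsProd X (power X n)))
    exact isProper_of_iso e

/-! ### Complex points of affine spaces -/

/-- The complex point of affine space all of whose coordinates are equal to `c`. -/
def constPoint (σ : Type) (c : Γ(Spec (CommRingCat.of ℂ), ⊤)) : Points (affineSpace σ) :=
  Over.homMk (AffineSpace.homOfVector (𝟙 _) fun _ ↦ c) (AffineSpace.homOfVector_over _ _)

lemma constPoint_injective (σ : Type) [Nonempty σ] : Function.Injective (constPoint σ) := by
  intro c d h
  obtain ⟨s⟩ := ‹Nonempty σ›
  have h (c) : (constPoint σ c).left.appTop (AffineSpace.coord _ s) = c :=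
    AffineSpace.homOfVector_appTop_coord _ _ s
  rw [← h c, ‹constPoint σ c = _›, h d]

/-- A chart of positive dimension contains the two distinct points `(0, …, 0)` and `(1, …, 1)`. -/
lemma HasAffineSpaceCover.exists_ne {σ : Type} [Nonempty σ] {Z : SchC} {p : Points Z}
    (h : HasAffineSpaceCover σ Z p) (e : Points Z) : ∃ x : Points Z, x ≠ e := by
  obtain ⟨g, hg, -, -⟩ := h p.pt
  have := mono_of_isOpenImmersion g
  have : Nontrivial Γ(Spec (CommRingCat.of ℂ), ⊤) :=
    (Scheme.ΓSpecIso (CommRingCat.of ℂ)).commRingCatIsoToRingEquiv.toEquiv.nontrivial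
  by_contra! hall
  have h01 : constPoint σ 0 ≫ g = constPoint σ 1 ≫ g := (hall _).trans (hall _).symm
  exact zero_ne_one (constPoint_injective σ ((cancel_mono g).mp h01))

/-! ### The James equivalence relation -/

section james

variable {X : Type*} {e : X} {n : ℕ}

open Classical in
lemma filter_ofFn_insertNth (i : Fin (n + 1)) (y : Fin n → X) :
    (List.ofFn (i.insertNth (α := fun _ ↦ X) e y)).filter (· ≠ e) =
      (List.ofFn y).filter (· ≠ e) := by
  induction n with
  | zero =>
    obtain rfl := Fin.fin_one_eq_zero i
    simp
  | succ n ih =>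
    refine Fin.cases ?_ (fun j ↦ ?_) i
    · simp
    · have h : (fun a : Fin (n + 1) ↦ j.succ.insertNth (α := fun _ ↦ X) e y a.succ) =
          j.insertNth (α := fun _ ↦ X) e fun a ↦ y a.succ := by
        refine Fin.eq_insertNth_iff.mpr ⟨by simp, funext fun a ↦ ?_⟩
        simp [Fin.removeNth, ← Fin.succ_succAbove_succ]
      rw [List.ofFn_succ (n := n + 1), h, List.ofFn_succ (f := y), List.filter_cons,
        List.filter_cons, ih]
      have h0 : j.succ.insertNth (α := fun _ ↦ X) e y 0 = y 0 := by
        rw [← Fin.succ_succAbove_zero j, Fin.insertNth_apply_succAbove]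
      rw [h0]

open Classical in
/-- The word of entries different from the base point is an invariant of a class in `J_n(X)`. -/
def James.word (w : James e n) : List X :=
  Quot.lift (fun x : Fin n → X ↦ (List.ofFn x).filter (· ≠ e)) (by
    rintro _ _ ⟨i, y⟩
    rw [filter_ofFn_insertNth, ← Fin.insertNth_last', filter_ofFn_insertNth]) w

open Classical in
lemma James.word_mk (x : Fin n → X) :
    (James.mk e x).word = (List.ofFn x).filter (· ≠ e) := rfl

lemma James.mem_word_mk {x : Fin n → X} {i : Fin n} (h : x i ≠ e) : x i ∈ (James.mk e x).word := by
  simp [word_mk, h]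

/-- Each entry of a representative is `e` or a letter of the word, which leaves finitely many
tuples. -/
lemma James.finite_fiber (w : James e n) : {x : Fin n → X | James.mk e x = w}.Finite := by
  have hfin : (insert e {a | a ∈ w.word}).Finite := w.word.finite_toSet.insert e
  refine (Set.Finite.pi' fun _ : Fin n ↦ hfin).subset ?_
  rintro x rfl i
  by_cases h : x i = e
  · exact Or.inl h
  · exact Or.inr (mem_word_mk h)

lemma James.mk_inj_of_ne {x y : Fin n → X} (hx : ∀ i, x i ≠ e) (hy : ∀ i, y i ≠ e)
    (h : James.mk e x = James.mk e y) : x = y := by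
  have h := congrArg James.word h
  rw [word_mk, word_mk, List.filter_eq_self.mpr (by simpa using hx),
    List.filter_eq_self.mpr (by simpa using hy)] at h
  exact List.ofFn_injective h

lemma James.not_injective_mk (hn : 1 < n) {a : X} (ha : a ≠ e) :
    ¬ Function.Injective (James.mk e (n := n)) := by
  intro hinj
  obtain ⟨k, rfl⟩ : ∃ k, n = k + 2 := ⟨n - 2, by omega⟩
  -- The relation is `(e, a, …, a) ∼ (a, …, a, e)`; as there is at least one `a`, the first entries
  -- are `e` and `a`.
  have h := congrFun (hinj (Quot.sound (JamesRel.move (e := e) 0 fun _ : Fin (k + 1) ↦ a))) 0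
  exact ha (Eq.symm (by simpa using h))

end james

/-! ### Algebraic structures on `J_n(X)` -/

lemma genericPoint_map_of_surjective {X Y : Scheme.{0}} [IrreducibleSpace X] [IrreducibleSpace Y]
    (f : X ⟶ Y) [Surjective f] : f (genericPoint X) = genericPoint Y := by
  have h := (genericPoint_spec X).image f.continuous
  rw [Set.image_univ, f.surjective.range_eq, closure_univ] at h
  exact h.eq (genericPoint_spec Y)

/-- The generic stalk does not change on passing to a nonempty open subscheme, so universal
injectivity is needed only there. -/
lemma isIso_stalkMap_of_restrict {X Y : Scheme.{0}} [IsIntegral X] [IsIntegral Y]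
    (g : Y ⟶ Spec (.of ℂ)) (f : X ⟶ Y) (hf : f (genericPoint X) = genericPoint Y)
    (U : X.Opens) [Nonempty U] [UniversallyInjective (U.ι ≫ f)] :
    IsIso (f.stalkMap (genericPoint X)) := by
  have : IsIntegral U := inferInstance
  have hU : U.ι (genericPoint U) = genericPoint X := genericPoint_eq_of_isOpenImmersion U.ι
  have h1 := isIso_stalkMap_of_universallyInjective g (U.ι ≫ f)
    ((congrArg f hU).trans hf)
  rw [Scheme.Hom.stalkMap_comp] at h1
  rw [← hU]
  exact @IsIso.of_isIso_comp_right _ _ _ _ _ (f.stalkMap _) (U.ι.stalkMap (genericPoint U))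
    inferInstance h1

section

variable {σ : Type} [Finite σ] [Nonempty σ] {X : SchC} [IsProper X.hom] {p : Points X}
  (hX : HasAffineSpaceCover σ X p) {n : ℕ} (e : Points X) {Y : SchC} (hY : IsComplexVariety Y)
  (φ : James e n ≃ Points Y) (q : power X n ⟶ Y)
  (hq : ∀ x : Fin n → Points X, tuple x ≫ q = φ (James.mk e x))

/-- The open subset of `X ^ n` where no coordinate is the base point. -/
def offBasePoint (e : Points X) (n : ℕ) : (power X n).left.Opens :=
  ⟨⋂ i, (powerProj X i).left ⁻¹' {e.pt}ᶜ, isOpen_iInter_of_finite fun i ↦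
    (Points.isClosed_pt e).isOpen_compl.preimage (powerProj X i).left.continuous⟩

lemma pt_tuple_mem_offBasePoint {x : Fin n → Points X} :
    (tuple x).pt ∈ offBasePoint e n ↔ ∀ i, x i ≠ e := by
  refine Set.mem_iInter.trans (forall_congr' fun i ↦ ?_)
  rw [Set.mem_preimage, powerProj_pt_tuple]
  exact (Points.pt_injective X).ne_iff

include hY hq in
lemma universallyInjective_offBasePoint :
    UniversallyInjective ((offBasePoint e n).ι ≫ q.left) := by
  have := isProper_power X n
  have := hY.isSeparated
  have := hY.locallyOfFiniteType
  let Z : SchC := Over.mk ((offBasePoint e n).ι ≫ (power X n).hom)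
  let j : Z ⟶ power X n := Over.homMk (offBasePoint e n).ι
  have : IsOpenImmersion j.left := inferInstanceAs (IsOpenImmersion (offBasePoint e n).ι)
  have := mono_of_isOpenImmersion j
  have : LocallyOfFiniteType Z.hom :=
    inferInstanceAs (LocallyOfFiniteType ((offBasePoint e n).ι ≫ (power X n).hom))
  have : IsSeparated Z.hom :=
    inferInstanceAs (IsSeparated ((offBasePoint e n).ι ≫ (power X n).hom))
  have : IsSeparated (j ≫ q).left := by
    have h : IsSeparated ((j ≫ q).left ≫ Y.hom) := by rwa [Over.w]
    exact IsSeparated.of_comp _ Y.hom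
  refine universallyInjective_of_injective_points (j ≫ q) fun a b hab ↦ ?_
  obtain ⟨x, hx⟩ := exists_eq_tuple (a ≫ j)
  obtain ⟨y, hy⟩ := exists_eq_tuple (b ≫ j)
  have hmem (c : Points Z) : Points.pt (c ≫ j) ∈ offBasePoint e n := by
    rw [Points.pt_comp]
    exact (c.pt : offBasePoint e n).2
  have hxe := (pt_tuple_mem_offBasePoint e).mp (hx ▸ hmem a)
  have hye := (pt_tuple_mem_offBasePoint e).mp (hy ▸ hmem b)
  have hab : a ≫ j ≫ q = b ≫ j ≫ q := hab
  rw [← Category.assoc, ← Category.assoc, hx, hy, hq, hq] at hab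
  rw [← cancel_mono j, hx, hy, James.mk_inj_of_ne hxe hye (φ.injective hab)]

include hX hY hq in
theorem not_isNormalScheme_and_isNormalizationMap (hn : 1 < n) :
    ¬ IsNormalScheme Y.left ∧ IsNormalizationMap q.left := by
  have := isProper_power X n
  have := hY.isSeparated
  have := hY.locallyOfFiniteType
  have := hY.isReduced
  have hXn := hX.power n
  have : IsIntegral (power X n).left := hXn.isIntegral
  have : IsProper q.left := by
    have h : IsProper (q.left ≫ Y.hom) := by rwa [Over.w]
    exact IsProper.of_comp q.left Y.hom
  have : Surjective q.left := ⟨surjective_of_forall_point q q.left.isClosedMap fun y ↦ by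
    obtain ⟨x, hx⟩ := Quot.exists_rep (φ.symm y)
    exact ⟨tuple x, (hq x).trans ((congrArg φ hx).trans (φ.apply_symm_apply y))⟩⟩
  have : IrreducibleSpace Y.left := q.left.surjective.irreducibleSpace q.left.continuous
  have : IsIntegral Y.left := isIntegral_of_irreducibleSpace_of_isReduced _
  have : IsFinite q.left := isFinite_of_finite_fibers q fun w ↦ by
    refine ((James.finite_fiber (φ.symm w)).image tuple).subset fun a ha ↦ ?_
    obtain ⟨x, rfl⟩ := exists_eq_tuple a
    exact ⟨x, by rw [Set.mem_ofPred_eq, ← (show _ = w from ha), hq, φ.symm_apply_apply], rfl⟩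
  have hgen := genericPoint_map_of_surjective q.left
  obtain ⟨x, hx⟩ := hX.exists_ne e
  have : Nonempty (offBasePoint e n) :=
    ⟨_, (pt_tuple_mem_offBasePoint e (x := fun _ ↦ x)).mpr fun _ ↦ hx⟩
  have := universallyInjective_offBasePoint e hY φ q hq
  have := isIso_stalkMap_of_restrict Y.hom q.left hgen (offBasePoint e n)
  refine ⟨fun hnorm ↦ James.not_injective_mk hn hx fun a b hab ↦ tuple_injective ?_,
    isNormalizationMap_of_birational hXn.isNormalScheme q.left hgen⟩
  -- For normal `Y` the birational finite map `q` is invertible, so composing with it is injective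
  -- on complex points, against the failure of injectivity of `q_n`.
  have : IsIso q.left := isIso_of_birational hnorm q.left hgen
  have : IsIso q := (Over.isoMk (asIso q.left) (Over.w q)).isIso_hom
  rw [← cancel_mono q, hq, hq, hab]

end

end JamesVariety

end

theorem mainTheorem6 (m n : ℕ) (hm : 1 ≤ m) (hn : 1 < n)
    (e : JamesVariety.Points (JamesVariety.projSpace m))
    (Y : JamesVariety.SchC) (hY : JamesVariety.IsComplexVariety Y)
    (φ : JamesVariety.James e n ≃ JamesVariety.Points Y)
    (q : JamesVariety.power (JamesVariety.projSpace m) n ⟶ Y)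
    (hq : ∀ x : Fin n → JamesVariety.Points (JamesVariety.projSpace m),
      JamesVariety.tuple x ≫ q = φ (JamesVariety.James.mk e x)) :
    ¬ JamesVariety.IsNormalScheme Y.left ∧ JamesVariety.IsNormalizationMap q.left := by
  obtain ⟨p, hp⟩ := JamesVariety.exists_hasAffineSpaceCover_projSpace m
  have : Nonempty (Fin m) := ⟨⟨0, hm⟩⟩
  exact JamesVariety.not_isNormalScheme_and_isNormalizationMap hp e hY φ q hq hn
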